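/- **Theorem 3.1.** Let $g\in\mathbb{Q}[x,y]$ be square-free with $\deg_y g\ge 1$. Write $\mathrm{lc}_x(g)\in\mathbb{Q}[y]$ and $\mathrm{lc}_y(g)\in\mathbb{Q}[x]$ for the leading coefficients of $g$ with respect to $x$ and $y$, and $\mathrm{disc}_y(g)\in\mathbb{Q}[x]$ for its discriminant with respect to $y$ (equal to $1$ when $\deg_y g=1$). Let $[(a_0,b_0),\dots,(a_{s+1},b_{s+1})]$, $s\ge 0$, be a *general potential periodic interval set* of $g$, that is, a list of open intervals with $a_0=-\infty$, $b_{s+1}=+\infty$, all other endpoints rational, $b_0<0$, $a_{s+1}>0$, such that (i) $a_j<b_j$ and $b_j\le a_{j+1}$ for $1\le j\le s$; (ii) every real root of $\mathrm{lc}_x(g)$ lies in some $(a_j,b_j)$ with $1\le j\le s$, and none lies in $(a_0,b_0)$ or $(a_{s+1},b_{s+1})$; (iii) each $(a_j,b_j)$, $1\le j\le s$, contains at most one real root of $\mathrm{lc}_x(g)$. Let $M$ be the largest real root of $\mathrm{lc}_y(g)\cdot\mathrm{disc}_y(g)$ ($M=-\infty$ if there is none); $M$ is called the start-point. The *terminal-root-functions*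 of $g$ are analytic functions $\theta_1<\dots<\theta_r$ $(r\ge 0)$ on $(M,+\infty)$ such that for every $x>M$ the numbers $\theta_1(x),\dots,\theta_r(x)$ are exactly the real roots of $g(x,\cdot)$. Let $k'\in\mathbb{N}=\{0,1,2,\dots\}$ be such that $M'=(k'+\tfrac12)\pi$ is an upper bound of $M$ and of all real roots of the polynomial $\prod_{j=0}^{s} g(x,b_j)\,g(x,a_{j+1})$. Put $\arctan(\pm\infty)=\pm\pi/2$. Then the terminal-root-functions $\theta_1,\dots,\theta_r$ of $g$ exist, and: 1. For each $i$ $(1\le i\le r)$ there is $j_i$ $(0\le j_i\le s+1)$ such that $\theta_i(x)\in(a_{j_i},b_{j_i})$ for all $x>M'$. Moreover, for every choice of indices $j_1,\dots,j_r$ as in (1): 2. For every real root $\xi>M'$ of $g(x,\tan x)$ (where $\xi\notin\frac{\pi}{2}+\pi\mathbb{Z}$, so that $\tan\xi$ is defined) there are $k\in\mathbb{N}$ with $k>k'$ and $i$ $(1\le i\le r)$ such that $\xi\in(\arctan a_{j_i}+k\pi,\ \arctan b_{j_i}+k\pi)$. 3. For each $i$ $(1\le i\le r)$ and each $k\in\mathbb{N}$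 with $k>k'$ there is $\xi\in(\arctan a_{j_i}+k\pi,\ \arctan b_{j_i}+k\pi)$ with $\tan\xi=\theta_i(\xi)$. -/

import Mathlib

open Polynomial
open scoped Polynomial.Bivariate

/-! A bivariate polynomial `g ∈ ℚ[x, y]` is an element of `ℚ[X][Y]`: the inner variable is `x`, the
outer variable is `y`. So `g.natDegree`, `g.leadingCoeff`, `g.discr` are the degree, the leading
coefficient and the discriminant of `g` with respect to `y`, `g.eval (C q)` is `g(x, q) ∈ ℚ[x]`,
and `aevalAeval x y g` is the real number `g(x, y)` for real `x`, `y`. -/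

/-- The set of real roots of a univariate rational polynomial. -/
def realRoots (p : ℚ[X]) : Set ℝ := {x : ℝ | aeval x p = 0}

/-- The leading coefficient of `g` with respect to `x`, a polynomial in `y`. -/
noncomputable def leadingCoeffX (g : ℚ[X][Y]) : ℚ[X] := (Bivariate.swap g).leadingCoeff

/-- A list of `s + 2` open intervals `(a₀, b₀), …, (aₛ₊₁, bₛ₊₁)` with `a₀ = -∞`, `bₛ₊₁ = +∞` and all
other endpoints rational, recorded by its finite endpoints:
`b j` is `b_j` for `0 ≤ j ≤ s` and `a j` is `a_{j+1}` for `0 ≤ j ≤ s`. -/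
structure IntervalList (s : ℕ) where
  b : Fin (s + 1) → ℚ
  a : Fin (s + 1) → ℚ

namespace IntervalList

variable {s : ℕ}

/-- The left endpoint `a_j`, `0 ≤ j ≤ s + 1`, with `a₀ = -∞`. -/
noncomputable def left (I : IntervalList s) : Fin (s + 2) → EReal :=
  Fin.cons (α := fun _ => EReal) ⊥ (fun j => ((I.a j : ℝ) : EReal))

/-- The right endpoint `b_j`, `0 ≤ j ≤ s + 1`, with `bₛ₊₁ = +∞`. -/
noncomputable def right (I : IntervalList s) : Fin (s + 2) → EReal :=
  Fin.snoc (α := fun _ => EReal) (fun j => ((I.b j : ℝ) : EReal)) ⊤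

/-- The open interval `(a_j, b_j)` of real numbers, `0 ≤ j ≤ s + 1`. -/
def interval (I : IntervalList s) (j : Fin (s + 2)) : Set ℝ :=
  {y : ℝ | I.left j < (y : EReal) ∧ (y : EReal) < I.right j}

end IntervalList

/-- `I` is a general potential periodic interval set of `g`. The indices `1 ≤ j ≤ s` of the
bounded intervals are written as `j.succ.castSucc` with `j : Fin s`; then `j.succ.succ` is the
index that comes next. -/
structure IsGeneralPotentialPeriodicIntervalSet (g : ℚ[X][Y]) {s : ℕ} (I : IntervalList s) :
    Prop where
  right_zero_neg : I.right 0 < 0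
  left_last_pos : 0 < I.left (Fin.last (s + 1))
  left_lt_right : ∀ j : Fin s, I.left j.succ.castSucc < I.right j.succ.castSucc
  right_le_left_next : ∀ j : Fin s, I.right j.succ.castSucc ≤ I.left j.succ.succ
  root_mem : ∀ y ∈ realRoots (leadingCoeffX g), ∃ j : Fin s, y ∈ I.interval j.succ.castSucc
  root_notMem_first : ∀ y ∈ realRoots (leadingCoeffX g), y ∉ I.interval 0
  root_notMem_last : ∀ y ∈ realRoots (leadingCoeffX g), y ∉ I.interval (Fin.last (s + 1))
  at_most_one : ∀ j : Fin s,
    (I.interval j.succ.castSucc ∩ realRoots (leadingCoeffX g)).Subsingleton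

/-- The start-point `M` of the terminal-root-functions of `g`: the maximal real root of
`lc(g, y) · discrim(g, y)`, and `-∞` if this polynomial has no real root. -/
noncomputable def startPoint (g : ℚ[X][Y]) : EReal :=
  sSup ((fun x : ℝ => (x : EReal)) '' realRoots (g.leadingCoeff * g.discr))

/-- The half-line `(M, +∞)`, where `M` is the start-point. -/
def terminalDomain (g : ℚ[X][Y]) : Set ℝ := {x : ℝ | startPoint g < (x : EReal)}

/-- `θ₁ < ⋯ < θᵣ` are the terminal-root-functions of `g`: analytic functions on `(M, +∞)` whose
values at each point `x` of `(M, +∞)` are all the real roots of `g(x, y)`, in increasing order. -/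
structure IsTerminalRootFunctions (g : ℚ[X][Y]) {r : ℕ} (θ : Fin r → ℝ → ℝ) : Prop where
  analytic : ∀ i, AnalyticOnNhd ℝ (θ i) (terminalDomain g)
  strictMono : ∀ x ∈ terminalDomain g, StrictMono (fun i => θ i x)
  roots : ∀ x ∈ terminalDomain g, {y : ℝ | aevalAeval x y g = 0} = Set.range (fun i => θ i x)

/-- The arctangent on the extended real line, with `arctan (±∞) = ±π/2`. -/
noncomputable def arctanExt : EReal → ℝ
  | ⊥ => -(Real.pi / 2)
  | ⊤ => Real.pi / 2
  | (x : ℝ) => Real.arctan x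

/-! Right of the start-point the leading coefficient and discriminant in `y` do not vanish, so every
real root of `g(x, ·)` is simple and the roots are locally bounded. The implicit function theorem
continues each root analytically, compactness excludes new ones, and connectedness of the half-line
makes their number constant; this gives the `θ i`.

Beyond `M'` no `θ i` meets a finite endpoint, so each stays on one side of it. A `θ i` trapped
between consecutive intervals would give zeros of `g` with `x → ∞` and `y` in a compact set. This
forces a root of the leading coefficient in `x` there (`exists_root_leadingCoeffX`), but all such
roots lie inside the bounded intervals (`not_mem_gap`).

On each period the tangent runs over all of ℝ while `θ i` stays bounded, so the two graphs cross;
applying `arctan` locates the crossing. For `k = k' + 1` boundedness requires `θ i` to be continuous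
at `M'` itself, that is `M < M'`, whereas only `M ≤ M'` is given. Equality would make π algebraic,
hence the transcendence proof. -/

/-! ### Transcendence of π -/

/-- If `a • s` is integral, then so is `a ^ N • g(s)` for an integer polynomial `g` of degree at
most `N`. -/
theorem isIntegral_pow_mul_aeval {K : Type*} [CommRing K] {a : ℤ} {s : K}
    (hs : IsIntegral ℤ (a • s)) (g : ℤ[X]) {N : ℕ} (hN : g.natDegree ≤ N) :
    IsIntegral ℤ ((a : K) ^ N * aeval s g) := by
  rw [aeval_eq_sum_range, Finset.mul_sum]
  refine IsIntegral.sum _ fun i hi => ?_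
  have hi' : i ≤ N := (Nat.lt_succ_iff.mp (Finset.mem_range.mp hi)).trans hN
  have h : (a : K) ^ N * g.coeff i • s ^ i
      = ((a ^ (N - i) * g.coeff i : ℤ) : K) * (a • s) ^ i := by
    rw [zsmul_eq_mul, zsmul_eq_mul, mul_pow]
    nth_rewrite 1 [← Nat.sub_add_cancel hi']
    push_cast
    ring
  rw [h]
  exact (isIntegral_algebraMap (R := ℤ) (A := K)
    (x := a ^ (N - i) * g.coeff i)).mul (hs.pow i)

/-- Finitely many nonzero algebraic numbers are roots of a single integer polynomial with nonzero
constant coefficient. -/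
theorem exists_int_polynomial_coeff_zero_ne_zero {K ι : Type*} [Field K]
    (T : Finset ι) (β : ι → K) (halg : ∀ i ∈ T, IsAlgebraic ℤ (β i)) (h0 : ∀ i ∈ T, β i ≠ 0) :
    ∃ F : ℤ[X], F.coeff 0 ≠ 0 ∧ ∀ i ∈ T, aeval (β i) F = 0 := by
  classical
  induction T using Finset.induction_on with
  | empty => exact ⟨1, by simp, by simp⟩
  | insert j T hj ih =>
    obtain ⟨F, hF0, hF⟩ := ih (fun i hi => halg i (Finset.mem_insert_of_mem hi))
      (fun i hi => h0 i (Finset.mem_insert_of_mem hi))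
    obtain ⟨q, hq0, hq⟩ := IsAlgebraic.exists_nonzero_coeff_and_aeval_eq_zero
      (halg j (Finset.mem_insert_self _ _))
      (mem_nonZeroDivisors_of_ne_zero (h0 j (Finset.mem_insert_self _ _)))
    refine ⟨q * F, by simp [mul_coeff_zero, hq0, hF0], fun i hi => ?_⟩
    rcases Finset.mem_insert.mp hi with rfl | hi
    · simp [hq]
    · simp [hF i hi]

/-- The sum of the exponentials of a Galois-stable family of algebraic numbers, at least one of
which is zero, does not vanish. -/
theorem sum_exp_ne_zero_of_galois_stable {K : Type*} [Field K] [CharZero K]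
    [FiniteDimensional ℚ K] [IsGalois ℚ K] (φ : K →+* ℂ) {ι : Type*} [Fintype ι] (β : ι → K)
    (hβ : ∀ σ : Gal(K/ℚ), ∃ e : Equiv.Perm ι, ∀ i, σ (β i) = β (e i))
    (h0 : ∃ i, β i = 0) : ∑ i, Complex.exp (φ (β i)) ≠ 0 := by
  classical
  intro hsum
  set T := Finset.univ.filter fun i => β i ≠ 0 with hT
  set q := (Finset.univ.filter fun i => β i = 0).card with hq
  have hqpos : 0 < q := by
    obtain ⟨i, hi⟩ := h0
    exact Finset.card_pos.mpr ⟨i, by simp [hi]⟩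
  have halg (i : ι) : IsAlgebraic ℤ (β i) :=
    (IsFractionRing.isAlgebraic_iff ℤ ℚ K).mpr (Algebra.IsAlgebraic.isAlgebraic (β i))
  have hsplit : (q : ℂ) + ∑ i ∈ T, Complex.exp (φ (β i)) = 0 := by
    rw [← hsum, ← Finset.sum_filter_add_sum_filter_not Finset.univ (fun i => β i = 0), hq]
    congr 1
    rw [Finset.sum_congr rfl (g := fun _ => (1 : ℂ))]
    · simp
    · intro i hi
      simp [(Finset.mem_filter.mp hi).2]
  obtain ⟨F, hF0, hF⟩ := exists_int_polynomial_coeff_zero_ne_zero T β (fun i _ => halg i)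
    (fun i hi => (Finset.mem_filter.mp hi).2)
  have hFne : F ≠ 0 := fun h => hF0 (by simp [h])
  set a := F.leadingCoeff with ha
  have ha0 : a ≠ 0 := leadingCoeff_ne_zero.mpr hFne
  have hint (i : ι) (hi : i ∈ T) : IsIntegral ℤ (a • β i) :=
    isIntegral_leadingCoeff_smul F (β i) (hF i hi)
  -- Hermite's approximation: for large primes `p`, with `p ∤ n`, the numbers `n • exp β` and `p •
  -- g(β)` differ by at most `c ^ p / (p - 1)!` at all roots `β` of `F`.
  obtain ⟨c, hc⟩ := LindemannWeierstrass.exp_polynomial_approx F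
    (by rwa [← coeff_zero_eq_eval_zero])
  set D := F.natDegree with hD
  have hlim : Filter.Tendsto (fun m : ℕ => (T.card : ℝ) * (|(a : ℝ)| ^ D * c) *
      ((|(a : ℝ)| ^ D * c) ^ m / (m.factorial : ℝ))) Filter.atTop (nhds 0) := by
    simpa using (FloorSemiring.tendsto_pow_div_factorial_atTop (|(a : ℝ)| ^ D * c)).const_mul
      ((T.card : ℝ) * (|(a : ℝ)| ^ D * c))
  obtain ⟨m₀, hm₀⟩ := Filter.eventually_atTop.mp (hlim.eventually (gt_mem_nhds one_pos))
  -- `p` exceeds `|F(0)|` for the approximation, `|a|` and `q` so that it divides neither, and `m₀`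
  -- so that the error is below 1.
  obtain ⟨p, hp, hpp⟩ := Nat.exists_infinite_primes
    ((eval 0 F).natAbs + a.natAbs + q + m₀ + 1)
  obtain ⟨n, hn, g, hg, happrox⟩ := hc p (by omega) hpp
  -- the sum of the values of `g` is rational
  have hfix (σ : Gal(K/ℚ)) : σ (∑ i ∈ T, aeval (β i) g) = ∑ i ∈ T, aeval (β i) g := by
    obtain ⟨e, he⟩ := hβ σ
    rw [hT, Finset.sum_filter, map_sum,
      ← Equiv.sum_comp e (fun i => if β i ≠ 0 then aeval (β i) g else 0)]
    refine Finset.sum_congr rfl fun i _ => ?_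
    have hiff : β (e i) = 0 ↔ β i = 0 := by
      rw [← he, map_eq_zero_iff σ σ.injective]
    have hσ : σ (aeval (β i) g) = aeval (β (e i)) g := by
      rw [← he]
      exact (aeval_algHom_apply (σ : K →+* K).toIntAlgHom (β i) g).symm
    by_cases h : β i = 0
    · simp [h, hiff.mpr h]
    · simp [h, hiff.not.mpr h, hσ]
  obtain ⟨r, hr⟩ := IntermediateField.mem_bot.mp ((IsGalois.mem_bot_iff_fixed _).mpr hfix)
  have hSint : IsIntegral ℤ ((a : K) ^ (p * D) * ∑ i ∈ T, aeval (β i) g) := by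
    rw [Finset.mul_sum]
    exact IsIntegral.sum _ fun i hi =>
      isIntegral_pow_mul_aeval (hint i hi) g (hg.trans (Nat.sub_le _ _))
  -- A rational number that is integral over ℤ is an integer.
  obtain ⟨m, hm⟩ : ∃ m : ℤ, (m : ℚ) = (a : ℚ) ^ (p * D) * r := by
    refine IsIntegrallyClosed.isIntegral_iff.mp ?_
    rw [← isIntegral_algebraMap_iff (B := K) (algebraMap ℚ K).injective]
    rw [map_mul, hr]
    simpa using hSint
  have hmC : (m : ℂ) = (a : ℂ) ^ (p * D) * φ (∑ i ∈ T, aeval (β i) g) := by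
    rw [← hr, eq_ratCast, map_ratCast]
    have := congrArg (fun x : ℚ => (x : ℂ)) hm
    simpa using this
  have hφ : φ (∑ i ∈ T, aeval (β i) g) = ∑ i ∈ T, aeval (φ (β i)) g := by
    rw [map_sum]
    refine Finset.sum_congr rfl fun i _ => ?_
    exact (aeval_algHom_apply φ.toIntAlgHom (β i) g).symm
  -- The left side is an integer, the right side is small: the integer is zero, so `p` divides `a ^
  -- (p * D) * n * q`, which is impossible.
  have hkey : ((a ^ (p * D) * n * q + p * m : ℤ) : ℂ) = -((a : ℂ) ^ (p * D) *
      ∑ i ∈ T, (n • Complex.exp (φ (β i)) - p • aeval (φ (β i)) g)) := by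
    simp only [zsmul_eq_mul, nsmul_eq_mul]
    rw [Finset.sum_sub_distrib, ← Finset.mul_sum, ← Finset.mul_sum, ← hφ]
    push_cast
    rw [hmC]
    linear_combination ((a : ℂ) ^ (p * D) * n) * hsplit
  have hbound : |((a ^ (p * D) * n * q + p * m : ℤ) : ℝ)| < 1 := by
    have h1 : |((a ^ (p * D) * n * q + p * m : ℤ) : ℝ)|
        = ‖((a ^ (p * D) * n * q + p * m : ℤ) : ℂ)‖ := by
      rw [Complex.norm_intCast]
    rw [h1, hkey, norm_neg, norm_mul, norm_pow, Complex.norm_intCast]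
    have h2 : ‖∑ i ∈ T, (n • Complex.exp (φ (β i)) - p • aeval (φ (β i)) g)‖
        ≤ T.card * (c ^ p / ((p - 1).factorial : ℝ)) := by
      refine (norm_sum_le_of_le T (f := fun i => n • Complex.exp (φ (β i)) - p • aeval (φ (β i)) g)
        (n := fun _ => c ^ p / ((p - 1).factorial : ℝ)) fun i hi => happrox ?_).trans (by simp)
      rw [mem_aroots]
      refine ⟨hFne, ?_⟩
      refine (aeval_algHom_apply φ.toIntAlgHom (β i) F).trans ?_
      rw [hF i hi, map_zero]
    refine (mul_le_mul_of_nonneg_left h2 (by positivity)).trans_lt ?_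
    refine lt_of_eq_of_lt ?_ (hm₀ (p - 1) (by omega))
    obtain ⟨t, rfl⟩ : ∃ t, p = t + 1 := ⟨p - 1, by omega⟩
    rw [Nat.add_sub_cancel]
    ring
  have hzero : a ^ (p * D) * n * q + p * m = 0 := by
    rw [← Int.abs_lt_one_iff]
    exact_mod_cast hbound
  have hdvd : (p : ℤ) ∣ a ^ (p * D) * n * q :=
    ⟨-m, by linear_combination hzero⟩
  have hpI : Prime (p : ℤ) := Nat.prime_iff_prime_int.mp hpp
  rcases hpI.dvd_or_dvd hdvd with h | h
  · rcases hpI.dvd_or_dvd h with h | h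
    · have h := Int.natAbs_dvd_natAbs.mpr (hpI.dvd_of_dvd_pow h)
      have := Nat.le_of_dvd (Int.natAbs_pos.mpr ha0) h
      simp at this
      omega
    · exact hn h
  · have := Nat.le_of_dvd hqpos (Int.natCast_dvd_natCast.mp h)
    omega

/-- Otherwise the product of `1 + exp(σ α)` over the Galois group vanishes. Expanded, it is a sum of
exponentials of the subset sums of conjugates, a Galois-stable family in which the empty subset
contributes the exponent 0. -/
theorem exp_ne_neg_one_of_isAlgebraic {α : ℂ} (hα : IsAlgebraic ℚ α) : Complex.exp α ≠ -1 := by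
  classical
  intro hexp
  have hint : IsIntegral ℚ α := hα.isIntegral
  set P := minpoly ℚ α
  have hP : (P.map (algebraMap ℚ ℂ)).Splits := IsAlgClosed.splits _
  let K := IntermediateField.adjoin ℚ (P.rootSet ℂ)
  have hK : P.IsSplittingField ℚ K := IntermediateField.adjoin_rootSet_isSplittingField hP
  have : FiniteDimensional ℚ K := IsSplittingField.finiteDimensional K P
  have : Normal ℚ K := Normal.of_isSplittingField P
  have : IsGalois ℚ K := IsGalois.mk
  have hmem : α ∈ K := IntermediateField.subset_adjoin _ _
    (mem_rootSet.mpr ⟨minpoly.ne_zero hint, minpoly.aeval ℚ α⟩)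
  let a : K := ⟨α, hmem⟩
  refine sum_exp_ne_zero_of_galois_stable (K := K) K.val.toRingHom
    (fun S : Finset Gal(K/ℚ) => ∑ σ ∈ S, σ a) (fun τ => ?_) ⟨∅, by simp⟩ ?_
  · refine ⟨(Equiv.mulLeft τ).finsetCongr, fun S => ?_⟩
    simp [Finset.sum_map, map_sum]
  · have h : ∏ σ : Gal(K/ℚ), (1 + Complex.exp (K.val (σ a))) = 0 :=
      Finset.prod_eq_zero (Finset.mem_univ 1) (by simp [a, hexp])
    rw [Finset.prod_one_add, Finset.powerset_univ] at h
    rw [← h]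
    refine Finset.sum_congr rfl fun S _ => ?_
    rw [map_sum, Complex.exp_sum]
    rfl

theorem Real.transcendental_pi : Transcendental ℚ Real.pi := by
  intro h
  have hI : IsAlgebraic ℚ Complex.I :=
    ⟨X ^ 2 + 1, by
      intro h
      have := congrArg (eval 0) h
      simp at this, by simp⟩
  have hpi : IsAlgebraic ℚ (Real.pi : ℂ) := h.algebraMap (A := ℂ)
  exact exp_ne_neg_one_of_isAlgebraic (hpi.mul hI) Complex.exp_pi_mul_I

/-! ### Local structure of the real roots of `g(x, ·)` -/

theorem aevalAeval_eq_eval_map (g : ℚ[X][Y]) (x y : ℝ) :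
    aevalAeval x y g = (g.map (aeval x : ℚ[X] →ₐ[ℚ] ℝ).toRingHom).eval y := by
  induction g using Polynomial.induction_on' with
  | add p q hp hq => rw [map_add, Polynomial.map_add, eval_add, hp, hq]
  | monomial n a => simp

theorem aevalAeval_eq_sum (g : ℚ[X][Y]) (x y : ℝ) :
    aevalAeval x y g = ∑ i ∈ Finset.range (g.natDegree + 1), aeval x (g.coeff i) * y ^ i := by
  rw [aevalAeval_eq_eval_map, eval_map, eval₂_eq_sum_range]
  rfl

theorem contDiff_aevalAeval (g : ℚ[X][Y]) {n : WithTop ℕ∞} :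
    ContDiff ℝ n fun v : ℝ × ℝ => aevalAeval v.1 v.2 g := by
  simp_rw [aevalAeval_eq_sum]
  refine ContDiff.sum fun i _ => ContDiff.mul ?_ (contDiff_snd.pow i)
  exact (contDiff_aeval (g.coeff i) n).comp contDiff_fst

theorem hasDerivAt_aevalAeval (g : ℚ[X][Y]) (x y : ℝ) :
    HasDerivAt (fun t : ℝ => aevalAeval x t g) (aevalAeval x y (derivative g)) y := by
  simp_rw [aevalAeval_eq_eval_map, ← derivative_map]
  exact Polynomial.hasDerivAt _ y

/-- Away from the zeros of the leading coefficient and the discriminant, all roots are simple. -/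
theorem aevalAeval_derivative_ne_zero {g : ℚ[X][Y]} (hdeg : 1 ≤ g.natDegree) {x y : ℝ}
    (hx : aeval x (g.leadingCoeff * g.discr) ≠ 0) (hy : aevalAeval x y g = 0) :
    aevalAeval x y (derivative g) ≠ 0 := by
  intro hy'
  -- The resultant of `g` and its derivative is a combination of the two, and equals `lc · disc` up
  -- to sign; a common zero would kill it.
  obtain ⟨p, q, -, -, h⟩ := exists_mul_add_mul_eq_C_resultant (m := g.natDegree)
    (n := g.natDegree - 1) g (derivative g) le_rfl (natDegree_derivative_le g) (by omega)
  rw [resultant_deriv (natDegree_pos_iff_degree_pos.mp hdeg)] at h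
  have h' := congrArg (aevalAeval x y) h
  rw [map_add, map_mul, map_mul, hy, hy', aevalAeval_C] at h'
  apply hx
  simpa using h'

/-- Near a simple zero, the zero set is the graph of an analytic function. -/
theorem exists_analyticAt_local_root {g : ℚ[X][Y]} {x y : ℝ} (hy : aevalAeval x y g = 0)
    (hy' : aevalAeval x y (derivative g) ≠ 0) :
    ∃ φ : ℝ → ℝ, AnalyticAt ℝ φ x ∧ φ x = y ∧
      ∀ᶠ v in nhds (x, y), aevalAeval v.1 v.2 g = 0 ↔ φ v.1 = v.2 := by
  set f : ℝ × ℝ → ℝ := fun v => aevalAeval v.1 v.2 g with hf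
  -- In `WithTop ℕ∞` the order `⊤` means analytic, and the implicit function inherits it.
  have cdf : ContDiffAt ℝ ⊤ f (x, y) := (contDiff_aevalAeval g).contDiffAt
  have hne : (⊤ : WithTop ℕ∞) ≠ 0 := by simp
  have hderiv : (fderiv ℝ f (x, y) ∘L .inr ℝ ℝ ℝ) 1 = aevalAeval x y (derivative g) := by
    have h1 : HasFDerivAt f (fderiv ℝ f (x, y)) (x, y) :=
      (cdf.differentiableAt hne).hasFDerivAt
    have h2 := (h1.comp y (hasFDerivAt_prodMk_right x y)).hasDerivAt
    exact h2.unique (hasDerivAt_aevalAeval g x y)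
  have hinv : (fderiv ℝ f (x, y) ∘L .inr ℝ ℝ ℝ).IsInvertible := by
    refine ⟨ContinuousLinearEquiv.unitsEquivAut ℝ (Units.mk0 _ hy'), ?_⟩
    ext
    rw [hderiv]
    simp
  refine ⟨cdf.implicitFunction hne hinv, ?_, cdf.implicitFunction_apply_self hne hinv, ?_⟩
  · exact ContDiffAt.analyticAt (cdf.contDiffAt_implicitFunction hne hinv)
  · filter_upwards [cdf.eventually_apply_eq_iff_implicitFunction hne hinv] with v hv
    have h0 : f (x, y) = 0 := hy
    rwa [h0] at hv

/-- Where the leading coefficient does not vanish, the roots are locally bounded. -/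
theorem exists_eventually_root_abs_le {g : ℚ[X][Y]} {x : ℝ} (hx : aeval x g.leadingCoeff ≠ 0) :
    ∃ R : ℝ, ∀ᶠ z in nhds x, ∀ y : ℝ, aevalAeval z y g = 0 → |y| ≤ R := by
  set B : ℝ → ℝ := fun z => (∑ i ∈ Finset.range g.natDegree, |aeval z (g.coeff i)|) /
    |aeval z g.leadingCoeff| with hB
  have hBc : ContinuousAt B x := by
    refine ContinuousAt.div ?_ ?_ (abs_ne_zero.mpr hx)
    · exact (continuous_finsetSum _ fun i _ => (g.coeff i).continuous_aeval.abs).continuousAt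
    · exact g.leadingCoeff.continuous_aeval.abs.continuousAt
  have hne : ∀ᶠ z in nhds x, aeval z g.leadingCoeff ≠ 0 :=
    g.leadingCoeff.continuous_aeval.continuousAt.eventually_ne hx
  -- Cauchy's bound: a root with `|y| > 1` satisfies `|y| ≤ B z`. The extra 1 absorbs the variation
  -- of `B` near `x`.
  refine ⟨max 1 (B x + 1), ?_⟩
  filter_upwards [hne, hBc.eventually (gt_mem_nhds (lt_add_one (B x)))] with z hz hBz y hy
  by_contra! hlt
  obtain ⟨h1, h2⟩ := max_lt_iff.mp hlt
  rw [aevalAeval_eq_sum, Finset.sum_range_succ] at hy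
  have hpos : 0 < |aeval z g.leadingCoeff| := abs_pos.mpr hz
  have hy0 : 0 < |y| := one_pos.trans h1
  have hkey : |aeval z g.leadingCoeff| * |y| ^ g.natDegree * |y|
      ≤ (∑ i ∈ Finset.range g.natDegree, |aeval z (g.coeff i)|) * |y| ^ g.natDegree := by
    have h3 : |aeval z g.leadingCoeff| * |y| ^ g.natDegree
        = |∑ i ∈ Finset.range g.natDegree, aeval z (g.coeff i) * y ^ i| := by
      rw [← abs_pow, ← abs_mul, leadingCoeff, ← abs_neg]
      congr 1
      linear_combination -hy
    rw [h3, Finset.sum_mul]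
    refine (mul_le_mul_of_nonneg_right (Finset.abs_sum_le_sum_abs _ _) hy0.le).trans ?_
    rw [Finset.sum_mul]
    refine Finset.sum_le_sum fun i hi => ?_
    rw [abs_mul, abs_pow, mul_assoc, ← pow_succ]
    exact mul_le_mul_of_nonneg_left
      (pow_le_pow_right₀ h1.le (Finset.mem_range.mp hi)) (abs_nonneg _)
  have h4 : |aeval z g.leadingCoeff| * |y|
      ≤ ∑ i ∈ Finset.range g.natDegree, |aeval z (g.coeff i)| := by
    refine le_of_mul_le_mul_right ?_ (pow_pos hy0 g.natDegree)
    linarith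
  have h5 : |y| ≤ B z := by
    rw [hB, le_div_iff₀ hpos]
    linarith
  linarith

theorem finite_setOf_aevalAeval_eq_zero {g : ℚ[X][Y]} {x : ℝ}
    (hx : aeval x g.leadingCoeff ≠ 0) : {y : ℝ | aevalAeval x y g = 0}.Finite := by
  have hne : g.map (aeval x : ℚ[X] →ₐ[ℚ] ℝ).toRingHom ≠ 0 := fun h =>
    hx (by simpa using congrArg (fun p => p.coeff g.natDegree) h)
  refine (finite_setOfPred_isRoot hne).subset fun y hy => ?_
  rw [Set.mem_ofPred_eq, aevalAeval_eq_eval_map] at hy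
  exact hy

/-- Near a point where neither the leading coefficient nor the discriminant vanishes, the real
roots are given by finitely many analytic functions. -/
theorem exists_analyticAt_local_roots {g : ℚ[X][Y]} (hdeg : 1 ≤ g.natDegree) {x : ℝ}
    (hx : aeval x (g.leadingCoeff * g.discr) ≠ 0) :
    ∃ (r : ℕ) (φ : Fin r → ℝ → ℝ), (∀ i, AnalyticAt ℝ (φ i) x) ∧
      ∀ᶠ z in nhds x, StrictMono (fun i => φ i z) ∧
        {y : ℝ | aevalAeval z y g = 0} = Set.range fun i => φ i z := by
  have hlc : aeval x g.leadingCoeff ≠ 0 := by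
    rw [map_mul] at hx
    exact left_ne_zero_of_mul hx
  have hfin := finite_setOf_aevalAeval_eq_zero hlc
  set S := hfin.toFinset with hS
  set u := S.orderEmbOfFin rfl with hu
  have hmem (y : ℝ) : aevalAeval x y g = 0 ↔ ∃ i, u i = y := by
    rw [← Set.mem_range, hu, Finset.range_orderEmbOfFin]
    simp [hS]
  have hroot (i) : aevalAeval x (u i) g = 0 := (hmem _).mpr ⟨i, rfl⟩
  choose φ hφan hφx hφ using fun i =>
    exists_analyticAt_local_root (hroot i) (aevalAeval_derivative_ne_zero hdeg hx (hroot i))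
  refine ⟨S.card, φ, hφan, ?_⟩
  have hmono : ∀ᶠ z in nhds x, StrictMono fun i => φ i z := by
    have : ∀ᶠ z in nhds x, ∀ i j, i < j → φ i z < φ j z := by
      refine Filter.eventually_all.mpr fun i => Filter.eventually_all.mpr fun j => ?_
      by_cases hij : i < j
      · have hlt : φ i x < φ j x := by
          rw [hφx, hφx]
          exact u.strictMono hij
        filter_upwards [(hφan i).continuousAt.eventually_lt (hφan j).continuousAt hlt] with z hz _
        exact hz
      · exact Filter.Eventually.of_forall fun z h => absurd h hij
    filter_upwards [this] with z hz i j hij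
    exact hz i j hij
  have hisroot : ∀ᶠ z in nhds x, ∀ i, aevalAeval z (φ i z) g = 0 := by
    refine Filter.eventually_all.mpr fun i => ?_
    have hc : Filter.Tendsto (fun z => (z, φ i z)) (nhds x) (nhds (x, u i)) := by
      have := (continuousAt_id (x := x)).prodMk (hφan i).continuousAt
      rwa [ContinuousAt, hφx] at this
    filter_upwards [hc.eventually (hφ i)] with z hz
    exact hz.mpr rfl
  obtain ⟨R, hR⟩ := exists_eventually_root_abs_le hlc
  -- No further roots appear: near `(x, y)` the zero set is a known graph or empty, and compactness
  -- makes this uniform over `[-R, R]`.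
  have hcover : ∀ᶠ z in nhds x, ∀ y ∈ Set.Icc (-R) R,
      aevalAeval z y g = 0 → ∃ i, φ i z = y := by
    refine isCompact_Icc.eventually_forall_of_forall_eventually fun y _ => ?_
    by_cases hy : aevalAeval x y g = 0
    · obtain ⟨i, rfl⟩ := (hmem y).mp hy
      filter_upwards [hφ i] with v hv h
      exact ⟨i, hv.mp h⟩
    · filter_upwards [(contDiff_aevalAeval g (n := 0)).continuous.continuousAt.eventually_ne
        (x := (x, y)) hy] with v hv h
      exact absurd h hv
  filter_upwards [hmono, hisroot, hR, hcover] with z h1 h2 h3 h4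
  refine ⟨h1, Set.ext fun y => ⟨fun hy => ?_, ?_⟩⟩
  · exact h4 y (abs_le.mp (h3 y hy)) hy
  · rintro ⟨i, rfl⟩
    exact h2 i

/-! ### Terminal-root-functions and the start-point -/

theorem isOpen_terminalDomain (g : ℚ[X][Y]) : IsOpen (terminalDomain g) :=
  isOpen_lt continuous_const continuous_coe_real_ereal

theorem isPreconnected_terminalDomain (g : ℚ[X][Y]) : IsPreconnected (terminalDomain g) := by
  refine Set.OrdConnected.isPreconnected ⟨fun x hx y _ z hz => ?_⟩
  exact lt_of_lt_of_le hx (EReal.coe_le_coe_iff.mpr hz.1)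

theorem aeval_ne_zero_of_mem_terminalDomain {g : ℚ[X][Y]} {x : ℝ} (hx : x ∈ terminalDomain g) :
    aeval x (g.leadingCoeff * g.discr) ≠ 0 := by
  intro h
  have hle : (x : EReal) ≤ startPoint g := le_sSup (Set.mem_image_of_mem _ h)
  exact absurd hle (not_le_of_gt hx)

/-- The number of real roots is locally constant on a connected set, hence constant. The increasing
enumeration of the roots is unique, so it agrees with the local analytic branches. -/
theorem exists_isTerminalRootFunctions {g : ℚ[X][Y]} (hdeg : 1 ≤ g.natDegree) :
    ∃ (r : ℕ) (θ : Fin r → ℝ → ℝ), IsTerminalRootFunctions g θ := by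
  classical
  rcases (terminalDomain g).eq_empty_or_nonempty with hE | ⟨x₀, hx₀⟩
  · exact ⟨0, fun _ => 0, fun i => i.elim0, by simp [hE], by simp [hE]⟩
  set N : ℝ → ℕ := fun x => {y : ℝ | aevalAeval x y g = 0}.ncard with hN
  have hcard {r : ℕ} {x : ℝ} {u : Fin r → ℝ} (hu : StrictMono u)
      (h : {y : ℝ | aevalAeval x y g = 0} = Set.range u) : N x = r := by
    rw [hN]
    simp only [h]
    rw [← Set.image_univ, Set.ncard_image_of_injective _ hu.injective, Set.ncard_univ,
      Nat.card_fin]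
  have hloc {x : ℝ} (hx : x ∈ terminalDomain g) : ∃ φ : Fin (N x) → ℝ → ℝ,
      (∀ i, AnalyticAt ℝ (φ i) x) ∧ ∀ᶠ z in nhds x, StrictMono (fun i => φ i z) ∧
        {y : ℝ | aevalAeval z y g = 0} = Set.range fun i => φ i z := by
    obtain ⟨r, φ, h1, h2⟩ := exists_analyticAt_local_roots hdeg
      (aeval_ne_zero_of_mem_terminalDomain hx)
    obtain rfl : N x = r := hcard h2.self_of_nhds.1 h2.self_of_nhds.2
    exact ⟨φ, h1, h2⟩
  have hcont : ContinuousOn N (terminalDomain g) := fun x hx => by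
    obtain ⟨φ, -, h2⟩ := hloc hx
    refine (continuousAt_const (y := N x)).congr ?_ |>.continuousWithinAt
    filter_upwards [h2] with z hz
    exact (hcard hz.1 hz.2).symm
  have hconst {x : ℝ} (hx : x ∈ terminalDomain g) : N x = N x₀ :=
    (isPreconnected_terminalDomain g).constant hcont hx hx₀
  have hex (x : ℝ) : ∃ u : Fin (N x₀) → ℝ, x ∈ terminalDomain g → StrictMono u ∧
      {y : ℝ | aevalAeval x y g = 0} = Set.range u := by
    by_cases hx : x ∈ terminalDomain g
    · obtain ⟨φ, -, h2⟩ := hconst hx ▸ hloc hx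
      exact ⟨fun i => φ i x, fun _ => h2.self_of_nhds⟩
    · exact ⟨fun _ => 0, fun h => absurd h hx⟩
  choose u hu using hex
  refine ⟨N x₀, fun i x => u x i, fun i x hx => ?_, fun x hx => (hu x hx).1,
    fun x hx => (hu x hx).2⟩
  obtain ⟨φ, h1, h2⟩ := hconst hx ▸ hloc hx
  refine (h1 i).congr ?_
  filter_upwards [h2, (isOpen_terminalDomain g).mem_nhds hx] with z hz hzD
  exact congrFun ((hz.1.range_inj (hu z hzD).1).mp (hz.2.symm.trans (hu z hzD).2)) i

/-- The start-point, being algebraic or `-∞`, is not a positive half-integer multiple of `π`. -/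
theorem startPoint_lt_of_le {g : ℚ[X][Y]} {k' : ℕ} {M' : ℝ}
    (hM' : M' = ((k' : ℝ) + 1 / 2) * Real.pi) (hstart : startPoint g ≤ (M' : EReal)) :
    startPoint g < (M' : EReal) := by
  refine lt_of_le_of_ne hstart fun heq => ?_
  have hle {x : ℝ} (hx : x ∈ realRoots (g.leadingCoeff * g.discr)) : x ≤ M' :=
    EReal.coe_le_coe_iff.mp ((le_sSup (Set.mem_image_of_mem _ hx)).trans hstart)
  have hne : g.leadingCoeff * g.discr ≠ 0 := by
    intro h
    have : M' + 1 ≤ M' := hle (by simp [realRoots, h])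
    linarith
  have hfin : (realRoots (g.leadingCoeff * g.discr)).Finite := by
    refine ((g.leadingCoeff * g.discr).rootSet_finite ℝ).subset fun x hx => ?_
    exact mem_rootSet.mpr ⟨hne, hx⟩
  have hnonempty : (realRoots (g.leadingCoeff * g.discr)).Nonempty := by
    rw [Set.nonempty_iff_ne_empty]
    intro h
    rw [startPoint, h, Set.image_empty, sSup_empty] at heq
    exact EReal.bot_ne_coe M' heq
  obtain ⟨x, hx, hxM⟩ := (hnonempty.image fun x : ℝ => (x : EReal)).csSup_mem (hfin.image _)
  have hxM' : x = M' := EReal.coe_eq_coe_iff.mp (hxM.trans heq)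
  have halg : IsAlgebraic ℚ M' := ⟨_, hne, hxM' ▸ hx⟩
  have hq : IsAlgebraic ℚ ((((k' : ℚ) + 1 / 2)⁻¹ : ℚ) : ℝ) := isAlgebraic_algebraMap _
  have hpi : ((((k' : ℚ) + 1 / 2)⁻¹ : ℚ) : ℝ) * M' = Real.pi := by
    have : (k' : ℝ) + 1 / 2 ≠ 0 := by positivity
    rw [hM']
    push_cast
    field_simp
  exact Real.transcendental_pi (hpi ▸ hq.mul halg)

/-! ### Confinement of a root function to one interval -/

theorem aevalAeval_ratCast (g : ℚ[X][Y]) (x : ℝ) (q : ℚ) :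
    aevalAeval x (q : ℝ) g = aeval x (g.eval (C q)) := by
  induction g using Polynomial.induction_on' with
  | add p q hp hq => rw [map_add, eval_add, map_add, hp, hq]
  | monomial n a => simp

/-- If `g(x, y) = 0` for arbitrarily large `x` with `y` in a compact interval, then the leading
coefficient of `g` with respect to `x` has a root in this interval. -/
theorem exists_root_leadingCoeffX {g : ℚ[X][Y]} {p q : ℝ}
    (h : ∀ R : ℝ, ∃ x > R, ∃ y ∈ Set.Icc p q, aevalAeval x y g = 0) :
    ∃ y ∈ Set.Icc p q, y ∈ realRoots (leadingCoeffX g) := by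
  by_contra! hno
  -- With the variables exchanged, the local root bound applies at each `y`, and compactness makes
  -- it uniform.
  have hbdd : ∃ R : ℝ, ∀ y ∈ Set.Icc p q, ∀ x : ℝ,
      aevalAeval y x (Bivariate.swap g) = 0 → |x| ≤ R := by
    refine isCompact_Icc.induction_on
      (p := fun s => ∃ R : ℝ, ∀ y ∈ s, ∀ x : ℝ, aevalAeval y x (Bivariate.swap g) = 0 → |x| ≤ R)
      ⟨0, by simp⟩ ?_ ?_ ?_
    · rintro s t hst ⟨R, hR⟩
      exact ⟨R, fun y hy => hR y (hst hy)⟩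
    · rintro s t ⟨R, hR⟩ ⟨R', hR'⟩
      refine ⟨max R R', fun y hy x hx => ?_⟩
      rcases hy with hy | hy
      · exact (hR y hy x hx).trans (le_max_left _ _)
      · exact (hR' y hy x hx).trans (le_max_right _ _)
    · intro y hy
      obtain ⟨R, hR⟩ := exists_eventually_root_abs_le (g := Bivariate.swap g) (x := y) (hno y hy)
      exact ⟨_, mem_nhdsWithin_of_mem_nhds hR, R, fun z hz => hz⟩
  obtain ⟨R, hR⟩ := hbdd
  obtain ⟨x, hx, y, hy, hxy⟩ := h R
  have := hR y hy x (by rwa [Bivariate.aevalAeval_swap])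
  exact absurd ((le_abs_self x).trans this) (not_le_of_gt hx)

theorem forall_lt_or_forall_gt_of_forall_ne {f : ℝ → ℝ} {M c : ℝ}
    (hf : ContinuousOn f (Set.Ioi M)) (hne : ∀ x > M, f x ≠ c) :
    (∀ x > M, f x < c) ∨ ∀ x > M, c < f x := by
  by_contra! h
  obtain ⟨⟨x, hx, hxc⟩, y, hy, hyc⟩ := h
  obtain ⟨z, hz, hzc⟩ := isPreconnected_Ioi.intermediate_value hy hx hf ⟨hyc, hxc⟩
  exact hne z hz hzc

namespace IntervalList

variable {s : ℕ} (I : IntervalList s)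

theorem left_zero : I.left 0 = ⊥ := rfl

theorem left_succ (m : Fin (s + 1)) : I.left m.succ = ((I.a m : ℝ) : EReal) := rfl

theorem right_castSucc (m : Fin (s + 1)) : I.right m.castSucc = ((I.b m : ℝ) : EReal) :=
  Fin.snoc_castSucc ..

theorem right_last : I.right (Fin.last (s + 1)) = ⊤ := Fin.snoc_last ..

end IntervalList

namespace IsGeneralPotentialPeriodicIntervalSet

variable {g : ℚ[X][Y]} {s : ℕ} {I : IntervalList s}

theorem a_lt_b (hI : IsGeneralPotentialPeriodicIntervalSet g I) (l : Fin s) :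
    I.a l.castSucc < I.b l.succ := by
  have h := hI.left_lt_right l
  rw [I.right_castSucc, ← Fin.succ_castSucc, I.left_succ] at h
  exact_mod_cast h

theorem b_le_a (hI : IsGeneralPotentialPeriodicIntervalSet g I) (l : Fin s) :
    I.b l.succ ≤ I.a l.succ := by
  have h := hI.right_le_left_next l
  rw [I.right_castSucc, I.left_succ] at h
  exact_mod_cast h

theorem monotone_a (hI : IsGeneralPotentialPeriodicIntervalSet g I) : Monotone I.a :=
  Fin.monotone_iff_le_succ.mpr fun l => (hI.a_lt_b l).le.trans (hI.b_le_a l)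

/-- No root of the leading coefficient with respect to `x` lies between two consecutive
intervals. -/
theorem not_mem_gap (hI : IsGeneralPotentialPeriodicIntervalSet g I) (m : Fin (s + 1)) {c : ℝ}
    (hc : c ∈ realRoots (leadingCoeffX g)) : c ∉ Set.Icc (I.b m : ℝ) (I.a m) := by
  rintro ⟨hbc, hca⟩
  obtain ⟨l, hl, hr⟩ := hI.root_mem c hc
  rw [← Fin.succ_castSucc, I.left_succ, EReal.coe_lt_coe_iff] at hl
  rw [I.right_castSucc, EReal.coe_lt_coe_iff] at hr
  have hl' : I.a l.castSucc < I.a m := by exact_mod_cast hl.trans_le hca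
  have hr' : I.b m < I.b l.succ := by exact_mod_cast hbc.trans_lt hr
  have hlm : l.castSucc < m := hI.monotone_a.reflect_lt hl'
  rcases (Fin.castSucc_lt_iff_succ_le.mp hlm).eq_or_lt with rfl | hlt
  · exact lt_irrefl _ hr'
  · obtain ⟨m', rfl⟩ := Fin.exists_succ_eq.mpr (Fin.ne_zero_of_lt hlm)
    have h1 : l.succ ≤ m'.castSucc := Fin.le_castSucc_iff.mpr hlt
    exact absurd hr' (not_lt_of_ge (((hI.b_le_a l).trans (hI.monotone_a h1)).trans
      (hI.a_lt_b m').le))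

/-- A continuous real root of `g` that avoids all the endpoints stays in one interval. -/
theorem exists_forall_mem_interval (hI : IsGeneralPotentialPeriodicIntervalSet g I)
    {f : ℝ → ℝ} {M : ℝ} (hf : ContinuousOn f (Set.Ioi M))
    (hroot : ∀ x > M, aevalAeval x (f x) g = 0)
    (ha : ∀ m, ∀ x > M, f x ≠ I.a m) (hb : ∀ m, ∀ x > M, f x ≠ I.b m) :
    ∃ j, ∀ x, M < x → f x ∈ I.interval j := by
  classical
  -- The last interval whose left endpoint stays below `f`; index 0 qualifies because its left
  -- endpoint is `-∞`.
  obtain ⟨j, hj, hmax⟩ := (Finset.univ.filter fun j : Fin (s + 2) =>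
    ∀ x > M, I.left j < (f x : EReal)).exists_max_image id
      ⟨0, by simp [I.left_zero]⟩
  have hleft : ∀ x > M, I.left j < (f x : EReal) := (Finset.mem_filter.mp hj).2
  refine ⟨j, fun x hx => ⟨hleft x hx, ?_⟩⟩
  revert x
  induction j using Fin.lastCases with
  | last => simp [I.right_last]
  | cast m =>
    rcases forall_lt_or_forall_gt_of_forall_ne hf (hb m) with h | h
    · intro x hx
      rw [I.right_castSucc, EReal.coe_lt_coe_iff]
      exact h x hx
    · exfalso
      have h' : ∀ x > M, f x < I.a m := by
        refine (forall_lt_or_forall_gt_of_forall_ne hf (ha m)).resolve_right fun hgt => ?_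
        have hle : m.succ ≤ m.castSucc := hmax _ (Finset.mem_filter.mpr
          ⟨Finset.mem_univ _, fun x hx => (I.left_succ m).trans_lt
            (EReal.coe_lt_coe_iff.mpr (hgt x hx))⟩)
        exact absurd hle (not_le_of_gt Fin.castSucc_lt_succ)
      obtain ⟨c, hc, hcroot⟩ := exists_root_leadingCoeffX (g := g) (p := I.b m) (q := I.a m)
        fun R => by
          have hx : max M R + 1 > M := by linarith [le_max_left M R]
          exact ⟨max M R + 1, by linarith [le_max_right M R], f _,
            ⟨(h _ hx).le, (h' _ hx).le⟩, hroot _ hx⟩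
      exact hI.not_mem_gap m hcroot hc

end IsGeneralPotentialPeriodicIntervalSet

/-! ### Periods of the tangent -/

theorem arctanExt_lt_arctan {L : EReal} {y : ℝ} (h : L < (y : EReal)) :
    arctanExt L < Real.arctan y := by
  induction L with
  | bot => exact Real.neg_pi_div_two_lt_arctan y
  | top => exact absurd h not_top_lt
  | coe a => exact Real.arctan_strictMono (EReal.coe_lt_coe_iff.mp h)

theorem arctan_lt_arctanExt {U : EReal} {y : ℝ} (h : (y : EReal) < U) :
    Real.arctan y < arctanExt U := by
  induction U with
  | bot => exact absurd h not_lt_bot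
  | top => exact Real.arctan_lt_pi_div_two y
  | coe a => exact Real.arctan_strictMono (EReal.coe_lt_coe_iff.mp h)

theorem mem_Ioo_arctanExt_of_tan_mem_interval {s : ℕ} {I : IntervalList s} {j : Fin (s + 2)}
    {k : ℕ} {ξ : ℝ} (h1 : k * Real.pi - Real.pi / 2 < ξ) (h2 : ξ < k * Real.pi + Real.pi / 2)
    (h : Real.tan ξ ∈ I.interval j) :
    ξ ∈ Set.Ioo (arctanExt (I.left j) + (k : ℝ) * Real.pi)
      (arctanExt (I.right j) + (k : ℝ) * Real.pi) := by
  have harctan : Real.arctan (Real.tan ξ) = ξ - k * Real.pi := by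
    rw [← Real.tan_sub_nat_mul_pi ξ k]
    exact Real.arctan_tan (by linarith) (by linarith)
  have hl := arctanExt_lt_arctan h.1
  have hr := arctan_lt_arctanExt h.2
  rw [harctan] at hl hr
  exact ⟨by linarith, by linarith⟩

/-- Every real number where the tangent is defined lies in the interior of a period. -/
theorem exists_nat_period {k' : ℕ} {ξ : ℝ} (hξ : ((k' : ℝ) + 1 / 2) * Real.pi < ξ)
    (hcos : Real.cos ξ ≠ 0) :
    ∃ k : ℕ, k' < k ∧ k * Real.pi - Real.pi / 2 < ξ ∧ ξ < k * Real.pi + Real.pi / 2 := by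
  have hpi := Real.pi_pos
  have hnonneg : 0 ≤ ξ / Real.pi + 1 / 2 := by
    have : 0 < ξ := lt_trans (by positivity) hξ
    positivity
  -- `kπ` is the multiple of π nearest to `ξ`; the left end of its period is excluded by `cos ξ ≠
  -- 0`.
  set k := ⌊ξ / Real.pi + 1 / 2⌋₊ with hk
  have h1 : (k : ℝ) * Real.pi ≤ ξ + Real.pi / 2 := by
    have := mul_le_mul_of_nonneg_right (Nat.floor_le hnonneg) hpi.le
    rw [add_mul, div_mul_cancel₀ _ hpi.ne'] at this
    linarith
  have h2 : ξ + Real.pi / 2 < ((k : ℝ) + 1) * Real.pi := by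
    have := mul_lt_mul_of_pos_right (Nat.lt_floor_add_one (ξ / Real.pi + 1 / 2)) hpi
    rw [add_mul (ξ / Real.pi), div_mul_cancel₀ _ hpi.ne'] at this
    linarith
  refine ⟨k, ?_, lt_of_le_of_ne (by linarith) fun heq => hcos ?_, by linarith⟩
  · have h3 : ((k' : ℝ) + 1) * Real.pi < ((k : ℝ) + 1) * Real.pi := by linarith
    have h4 := lt_of_mul_lt_mul_right h3 hpi.le
    exact_mod_cast (add_lt_add_iff_right (1 : ℝ)).mp h4
  · rw [← heq, ← neg_sub, Real.cos_neg, Real.cos_sub_nat_mul_pi, Real.cos_pi_div_two, mul_zero]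

/-- A continuous function on a closed period takes the value of the tangent in the interior. -/
theorem exists_tan_eq {f : ℝ → ℝ} {k : ℕ}
    (hf : ContinuousOn f (Set.Icc (k * Real.pi - Real.pi / 2) (k * Real.pi + Real.pi / 2))) :
    ∃ ξ, k * Real.pi - Real.pi / 2 < ξ ∧ ξ < k * Real.pi + Real.pi / 2 ∧
      Real.tan ξ = f ξ := by
  obtain ⟨B, hB⟩ := isCompact_Icc.exists_bound_of_continuousOn hf
  have hmem (y : ℝ) : Real.arctan y + k * Real.pi ∈
      Set.Ioo (k * Real.pi - Real.pi / 2) (k * Real.pi + Real.pi / 2) :=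
    ⟨by linarith [Real.neg_pi_div_two_lt_arctan y], by linarith [Real.arctan_lt_pi_div_two y]⟩
  have htan (y : ℝ) : Real.tan (Real.arctan y + k * Real.pi) = y := by
    rw [Real.tan_add_nat_mul_pi, Real.tan_arctan]
  have hcont : ContinuousOn (fun x => Real.tan x - f x)
      (Set.Ioo (k * Real.pi - Real.pi / 2) (k * Real.pi + Real.pi / 2)) := by
    refine ContinuousOn.sub ?_ (hf.mono Set.Ioo_subset_Icc_self)
    refine Real.continuousOn_tan.mono fun x hx => ?_
    have hpos : 0 < Real.cos (x - k * Real.pi) :=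
      Real.cos_pos_of_mem_Ioo ⟨by linarith [hx.1], by linarith [hx.2]⟩
    intro h
    rw [Real.cos_sub_nat_mul_pi, h, mul_zero] at hpos
    exact lt_irrefl _ hpos
  -- As `|f| ≤ B`, the difference `tan - f` changes sign between the points of the period where the
  -- tangent is `-(B + 1)` and `B + 1`.
  have hlo := abs_lt.mp ((hB _ (Set.Ioo_subset_Icc_self (hmem (-(B + 1))))).trans_lt
    (lt_add_one B))
  have hhi := abs_lt.mp ((hB _ (Set.Ioo_subset_Icc_self (hmem (B + 1)))).trans_lt (lt_add_one B))
  obtain ⟨ξ, hξ, h0⟩ := isPreconnected_Ioo.intermediate_value (hmem (-(B + 1))) (hmem (B + 1))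
    hcont (show (0 : ℝ) ∈ Set.Icc _ _ by
      simp only [htan]
      exact ⟨by linarith [hlo.1], by linarith [hhi.2]⟩)
  exact ⟨ξ, hξ.1, hξ.2, sub_eq_zero.mp h0⟩

/-! ### The main theorem -/

theorem theorem3p1 (g : ℚ[X][Y]) (hsf : Squarefree g) (hdeg : 1 ≤ g.natDegree)
    (s : ℕ) (I : IntervalList s) (hI : IsGeneralPotentialPeriodicIntervalSet g I)
    (k' : ℕ) (M' : ℝ) (hM' : M' = ((k' : ℝ) + 1 / 2) * Real.pi)
    (hstart : startPoint g ≤ (M' : EReal))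
    (hroots : ∀ x ∈ realRoots
      (∏ j : Fin (s + 1), g.eval (C (I.b j)) * g.eval (C (I.a j))), x ≤ M') :
    -- the terminal-root-functions exist
    (∃ (r : ℕ) (θ : Fin r → ℝ → ℝ), IsTerminalRootFunctions g θ) ∧
    ∀ (r : ℕ) (θ : Fin r → ℝ → ℝ), IsTerminalRootFunctions g θ →
      -- (1)
      (∀ i : Fin r, ∃ j : Fin (s + 2), ∀ x : ℝ, M' < x → θ i x ∈ I.interval j) ∧
      -- for any indices as in (1):
      ∀ J : Fin r → Fin (s + 2),
        (∀ i : Fin r, ∀ x : ℝ, M' < x → θ i x ∈ I.interval (J i)) →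
        -- (2)
        (∀ ξ : ℝ, M' < ξ → Real.cos ξ ≠ 0 → aevalAeval ξ (Real.tan ξ) g = 0 →
          ∃ k : ℕ, k' < k ∧ ∃ i : Fin r,
            ξ ∈ Set.Ioo (arctanExt (I.left (J i)) + (k : ℝ) * Real.pi)
              (arctanExt (I.right (J i)) + (k : ℝ) * Real.pi)) ∧
        -- (3)
        (∀ i : Fin r, ∀ k : ℕ, k' < k →
          ∃ ξ ∈ Set.Ioo (arctanExt (I.left (J i)) + (k : ℝ) * Real.pi)
              (arctanExt (I.right (J i)) + (k : ℝ) * Real.pi),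
            Real.tan ξ = θ i ξ) := by
  have hdom {x : ℝ} (hx : M' ≤ x) : x ∈ terminalDomain g :=
    (startPoint_lt_of_le hM' hstart).trans_le (EReal.coe_le_coe_iff.mpr hx)
  refine ⟨exists_isTerminalRootFunctions hdeg, fun r θ hθ => ?_⟩
  have hcont (i : Fin r) : ContinuousOn (θ i) (terminalDomain g) := (hθ.analytic i).continuousOn
  have hmem {x : ℝ} (hx : M' ≤ x) (y : ℝ) : aevalAeval x y g = 0 ↔ ∃ i, θ i x = y := by
    have := hθ.roots x (hdom hx)
    rw [Set.ext_iff] at this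
    exact this y
  have hend (m : Fin (s + 1)) {x : ℝ} (hx : M' < x) :
      aeval x (g.eval (C (I.b m))) ≠ 0 ∧ aeval x (g.eval (C (I.a m))) ≠ 0 := by
    have h : aeval x (∏ j : Fin (s + 1), g.eval (C (I.b j)) * g.eval (C (I.a j))) ≠ 0 :=
      fun h => absurd (hroots x h) (not_le_of_gt hx)
    rw [map_prod, Finset.prod_ne_zero_iff] at h
    have := h m (Finset.mem_univ m)
    rw [map_mul] at this
    exact ⟨left_ne_zero_of_mul this, right_ne_zero_of_mul this⟩
  refine ⟨fun i => hI.exists_forall_mem_interval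
    ((hcont i).mono fun x hx => hdom (le_of_lt hx)) (fun x hx => (hmem hx.le _).mpr ⟨i, rfl⟩)
    (fun m x hx heq => (hend m hx).2 ?_) (fun m x hx heq => (hend m hx).1 ?_), fun J hJ => ⟨?_, ?_⟩⟩
  · rw [← aevalAeval_ratCast, ← heq]
    exact (hmem hx.le _).mpr ⟨i, rfl⟩
  · rw [← aevalAeval_ratCast, ← heq]
    exact (hmem hx.le _).mpr ⟨i, rfl⟩
  · intro ξ hξ hcos hroot
    obtain ⟨k, hk, h1, h2⟩ := exists_nat_period (hM' ▸ hξ) hcos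
    obtain ⟨i, hi⟩ := (hmem hξ.le _).mp hroot
    exact ⟨k, hk, i, mem_Ioo_arctanExt_of_tan_mem_interval h1 h2 (hi ▸ hJ i ξ hξ)⟩
  · intro i k hk
    -- Equality holds for `k = k' + 1`, so the closed period may contain `M'`; `hdom` covers this
    -- point because `M < M'`.
    have hle : M' ≤ k * Real.pi - Real.pi / 2 := by
      have : ((k' : ℝ) + 1) * Real.pi ≤ k * Real.pi :=
        mul_le_mul_of_nonneg_right (by exact_mod_cast hk) Real.pi_pos.le
      rw [hM']
      linarith
    obtain ⟨ξ, h1, h2, h3⟩ := exists_tan_eq (k := k)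
      ((hcont i).mono fun x hx => hdom (hle.trans hx.1))
    exact ⟨ξ, mem_Ioo_arctanExt_of_tan_mem_interval h1 h2 (h3 ▸ hJ i ξ (hle.trans_lt h1)), h3⟩
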